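/- Throughout, every finite alphabet $\Sigma$ has a distinguished blank symbol $\diamond$, and the blank of $\Sigma^r$ is $(\diamond,\dots,\diamond)$. Let $\alpha$ be an ordinal. An $(\alpha)$-word over $\Sigma$ is a map $w:\alpha\to\Sigma$ with $w(\beta)\ne\diamond$ for only finitely many $\beta<\alpha$. An ordinal automaton over $\Sigma$ consists of a finite state set $Q$, sets $I,F\subseteq Q$ of initial and final states, and a transition relation $\Delta\subseteq (Q\times\Sigma\times Q)\cup(2^Q\times Q)$. A run on an $(\alpha)$-word $w$ is a map $\rho:\alpha+1\to Q$ such that $(\rho(\beta),w(\beta),\rho(\beta+1))\in\Delta$ for all $\beta<\alpha$ and $(\lim_\beta \rho,\rho(\beta))\in\Delta$ for all limit ordinals $0<\beta\le\alpha$, where $\lim_\beta\rho=\{q\in Q:\forall\beta'<\beta\ \exists\beta''\ (\beta'<\beta''<\beta\text{ and }\rho(\beta'')=q)\}$. It is accepting if $\rho(0)\in I$ and $\rho(\alpha)\in F$. The language $L(\mathcal A)$ of an automaton $\mathcal A$ is the set of $(\alpha)$-words on which $\mathcal A$ has an accepting run. An automaton $\mathcal A$ over $\Sigma^r$ recognises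 the $r$-ary relation $R(\mathcal A)$ of all tuples $(w_1,\dots,w_r)$ of $(\alpha)$-words over $\Sigma$ whose convolution $\beta\mapsto(w_1(\beta),\dots,w_r(\beta))$ is in $L(\mathcal A)$. A structure $\mathfrak A$ over a finite relational signature $R_1,\dots,R_m$, with $R_i$ of arity $r_i$, is $(\alpha)$-automatic if there are a finite alphabet $\Sigma$, an automaton $\mathcal A$ over $\Sigma$, automata $\mathcal A_i$ over $\Sigma^{r_i}$ with $R(\mathcal A_i)\subseteq L(\mathcal A)^{r_i}$, and an automaton $\mathcal A_\approx$ over $\Sigma^2$ such that $R(\mathcal A_\approx)$ is a congruence on the structure $(L(\mathcal A),R(\mathcal A_1),\dots,R(\mathcal A_m))$ and the quotient of this structure by $R(\mathcal A_\approx)$ is isomorphic to $\mathfrak A$. The random (Rado) graph is the countable graph $(V,E)$, unique up to isomorphism, such that for any disjoint finite sets $V_0,V_1\subseteq V$ there is a vertex that is adjacent to every element of $V_0$ and to no element of $V_1$. **Theorem.** For every ordinal $\alpha$, the random graph, viewed as a structure with one binary relation (adjacency), is not $(\alpha)$-automatic. -/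

import Mathlib

universe u v w

/-- A graph is the random (Rado) graph if it is countable and, for any two disjoint finite sets
`V₀`, `V₁` of vertices, some vertex is adjacent to every element of `V₀` and to no element of `V₁`.
(All such graphs are isomorphic.) -/
def SimpleGraph.IsRandomGraph {V : Type u} (G : SimpleGraph V) : Prop :=
  Countable V ∧
    ∀ V₀ V₁ : Finset V, Disjoint V₀ V₁ →
      ∃ x : V, (∀ y ∈ V₀, G.Adj x y) ∧ (∀ y ∈ V₁, ¬ G.Adj x y)

namespace OrdinalAutomata

/-- The finite `α`-words over an alphabet `Γ` with blank symbol `default`: maps from the ordinal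
`α = {β | β < α}` to `Γ` with finite support. The blank symbol of the alphabet `Fin r → Γ` is
the constant tuple with value the blank symbol of `Γ`. -/
def FinWord (Γ : Type u) [Inhabited Γ] (α : Ordinal.{v}) : Type (max u (v + 1)) :=
  {x : Set.Iio α → Γ // {β | x β ≠ default}.Finite}

/-- The convolution of an `r`-tuple of `α`-words over `Γ`, an `α`-word over `Γ^r`. -/
def FinWord.conv {Γ : Type u} [Inhabited Γ] {α : Ordinal.{v}} {r : ℕ}
    (x : Fin r → FinWord Γ α) : FinWord (Fin r → Γ) α :=
  ⟨fun β i => (x i).1 β, by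
    refine (Set.finite_iUnion fun i => (x i).2).subset fun β hβ => ?_
    by_contra h
    simp only [Set.mem_iUnion, Set.mem_ofPred_eq, not_exists, not_not] at h
    exact hβ (funext h)⟩

/-- An ordinal automaton over the alphabet `Γ`. The transition relation, a subset of
`(Q × Γ × Q) ∪ (2^Q × Q)`, is split into its two parts: the successor transitions `step` and the
limit transitions `lim`. -/
structure OrdinalAutomaton (Γ : Type u) where
  State : Type
  finite_state : Finite State
  initial : Set State
  final : Set State
  step : Set (State × Γ × State)
  lim : Set (Set State × State)

/-- The set of values that `r` takes cofinally often below `β`. -/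
def cofinalImages {Q : Type} {α : Ordinal.{v}} (r : Set.Iic α → Q) (β : Ordinal.{v}) : Set Q :=
  {q | ∀ β' < β, ∃ β'' : Set.Iic α, β' < β''.1 ∧ β''.1 < β ∧ r β'' = q}

namespace OrdinalAutomaton

variable {Γ : Type u} [Inhabited Γ]

/-- `r : α + 1 → Q` is a run of `A` on the `α`-word `x`. -/
def IsRun (A : OrdinalAutomaton Γ) {α : Ordinal.{v}} (x : FinWord Γ α)
    (r : Set.Iic α → A.State) : Prop :=
  (∀ (β : Ordinal.{v}) (h : β < α),
    (r ⟨β, h.le⟩, x.1 ⟨β, h⟩, r ⟨Order.succ β, Order.succ_le_of_lt h⟩) ∈ A.step) ∧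
  (∀ (β : Ordinal.{v}) (h : β ≤ α), Order.IsSuccLimit β →
    (cofinalImages r β, r ⟨β, h⟩) ∈ A.lim)

/-- The set of finite `α`-words that admit an accepting run of `A`. -/
def language (A : OrdinalAutomaton Γ) (α : Ordinal.{v}) : Set (FinWord Γ α) :=
  {x | ∃ r : Set.Iic α → A.State, A.IsRun x r ∧
    r ⟨0, Set.mem_Iic.2 zero_le⟩ ∈ A.initial ∧ r ⟨α, Set.mem_Iic.2 le_rfl⟩ ∈ A.final}

/-- The `r`-ary relation on finite `α`-words recognised by an `r`-dimensional automaton. -/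
def relation {r : ℕ} (A : OrdinalAutomaton (Fin r → Γ)) (α : Ordinal.{v}) :
    Set (Fin r → FinWord Γ α) :=
  {x | FinWord.conv x ∈ A.language α}

end OrdinalAutomaton

/-- An `(α)`-automatic presentation of a structure over a finite relational signature `L`:
automata recognising the domain, a relation for every symbol of `L`, and a congruence
on the resulting structure. -/
structure Presentation (α : Ordinal.{v}) (L : FirstOrder.Language.{0, w}) [L.IsRelational]
    [Finite (Σ n, L.Relations n)] where
  Alphabet : Type
  finite_alphabet : Finite Alphabet
  [blank : Inhabited Alphabet]
  domain : OrdinalAutomaton Alphabet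
  approx : OrdinalAutomaton (Fin 2 → Alphabet)
  rel : ∀ n : ℕ, L.Relations n → OrdinalAutomaton (Fin n → Alphabet)
  rel_on_domain : ∀ (n : ℕ) (R : L.Relations n), ∀ x ∈ (rel n R).relation α,
    ∀ i, x i ∈ domain.language α
  approx_on_domain : ∀ x ∈ approx.relation α, ∀ i, x i ∈ domain.language α
  approx_equivalence : Equivalence fun a b : domain.language α => ![a.1, b.1] ∈ approx.relation α
  approx_congruence : ∀ (n : ℕ) (R : L.Relations n) (x y : Fin n → domain.language α),
    (∀ i, ![(x i).1, (y i).1] ∈ approx.relation α) →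
      ((fun i => (x i).1) ∈ (rel n R).relation α ↔ (fun i => (y i).1) ∈ (rel n R).relation α)

namespace Presentation

variable {α : Ordinal.{v}} {L : FirstOrder.Language.{0, w}} [L.IsRelational]
  [Finite (Σ n, L.Relations n)] (P : Presentation α L)

instance : Inhabited P.Alphabet := P.blank

/-- The structure on the language of the domain automaton. -/
abbrev wordStructure : L.Structure (P.domain.language α) where
  funMap f := isEmptyElim f
  RelMap R x := (fun i => (x i).1) ∈ (P.rel _ R).relation α

/-- The recognised congruence. -/
def setoid : Setoid (P.domain.language α) :=
  ⟨fun a b => ![a.1, b.1] ∈ P.approx.relation α, P.approx_equivalence⟩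

/-- Together with `FirstOrder.Language.quotientStructure` this makes the quotient of the word
structure by the congruence an `L`-structure. -/
instance : L.Prestructure P.setoid where
  toStructure := P.wordStructure
  fun_equiv {_ f} := isEmptyElim f
  rel_equiv {n R} x y h := propext (P.approx_congruence n R x y h)

end Presentation

/-- A structure over a finite relational signature is `(α)`-automatic if it is isomorphic to the
quotient structure of some `(α)`-automatic presentation. -/
def IsAutomatic (α : Ordinal.{v}) (L : FirstOrder.Language.{0, w}) [L.IsRelational]
    [Finite (Σ n, L.Relations n)] (M : Type u) (S : L.Structure M) : Prop :=
  ∃ P : Presentation α L, Nonempty (L.Equiv (Quotient P.setoid) M)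

/-- The signature of graphs is finite. -/
instance : Finite (Σ n, FirstOrder.Language.graph.Relations n) :=
  Finite.of_injective (fun _ => ()) fun a b _ => by
    rcases a with ⟨_, ⟨⟩⟩
    rcases b with ⟨_, ⟨⟩⟩
    rfl

end OrdinalAutomata

/-! Finite words recognised by automata cannot encode enough independent neighbourhoods. Write `α`
as a finite sum of indecomposable ordinals. Words supported on the starting points of the `n`
summands number at most `K ^ n`, where `K` is the size of the alphabet. The heart of the proof is
`exists_replacement`: there is a refinement with at most `C * n` summands, `C` depending only on the
automata, such that every word `x` can be replaced by a word `y` supported on the new starting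
points. The automata for domain and adjacency cannot tell `x` from `y`, as long as the second
argument of adjacency is supported on the old starting points.

For one summand `κ` this holds because a finitely supported word on `κ > 1` lives on a prefix of
length `γ < κ`, and `γ + κ = κ` makes the blank tail independent of the prefix. Only the type of the
prefix matters, and there are finitely many types.

Iterating gives finite vertex sets `S n` of size at most `K ^ (C ^ n * c)`. By the extension
property every subset of `S n` is the trace of some neighbourhood, and replacement finds such a
vertex in `S (n + 1)`. Hence `2 ^ |S n| ≤ |S (n + 1)|`, a tower of exponentials that outgrows the
double exponential bound. -/

namespace OrdinalAutomata

open Ordinal Order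

/-! ### Runs on initial segments of total words -/

namespace OrdinalAutomaton

variable {Γ : Type u}

/-- The values that `r` takes cofinally often below `β`, for a map `r` on all ordinals. -/
def cofinalValues {Q : Type} (r : Ordinal.{v} → Q) (β : Ordinal.{v}) : Set Q :=
  {q | ∀ β' < β, ∃ β'', β' < β'' ∧ β'' < β ∧ r β'' = q}

/-- `A` has a run from `p` to `q` on the restriction of `x` to the ordinals below `γ`. -/
def Reach (A : OrdinalAutomaton Γ) (x : Ordinal.{v} → Γ) (γ : Ordinal.{v}) (p q : A.State) :
    Prop :=
  ∃ r : Ordinal.{v} → A.State, r 0 = p ∧ r γ = q ∧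
    (∀ β < γ, (r β, x β, r (succ β)) ∈ A.step) ∧
    (∀ β ≤ γ, IsSuccLimit β → (cofinalValues r β, r β) ∈ A.lim)

theorem cofinalValues_congr {Q : Type} {f g : Ordinal.{v} → Q} {γ β : Ordinal.{v}} (hγ : γ < β)
    (h : ∀ δ, γ < δ → δ < β → f δ = g δ) : cofinalValues f β = cofinalValues g β := by
  ext q
  constructor
  · intro hq b hb
    obtain ⟨c, hc, hcβ, rfl⟩ := hq (max b γ) (max_lt hb hγ)
    exact ⟨c, (le_max_left _ _).trans_lt hc, hcβ, (h c ((le_max_right _ _).trans_lt hc) hcβ).symm⟩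
  · intro hq b hb
    obtain ⟨c, hc, hcβ, rfl⟩ := hq (max b γ) (max_lt hb hγ)
    exact ⟨c, (le_max_left _ _).trans_lt hc, hcβ, h c ((le_max_right _ _).trans_lt hc) hcβ⟩

theorem cofinalValues_add {Q : Type} (f : Ordinal.{v} → Q) (γ : Ordinal.{v}) {β : Ordinal.{v}}
    (hβ : 0 < β) : cofinalValues (fun δ => f (γ + δ)) β = cofinalValues f (γ + β) := by
  ext q
  constructor
  · intro hq b hb
    obtain ⟨c, hc, hcβ, rfl⟩ := hq (b - γ) (sub_lt_of_lt_add hb hβ)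
    refine ⟨γ + c, ?_, by simpa using hcβ, rfl⟩
    exact (le_add_sub b γ).trans_lt (by simpa using hc)
  · intro hq b hb
    obtain ⟨c, hc, hcβ, rfl⟩ := hq (γ + b) (by simpa using hb)
    have hγ : γ ≤ c := le_self_add.trans hc.le
    refine ⟨c - γ, lt_sub.2 hc, (sub_lt_of_le hγ).2 hcβ, ?_⟩
    simp only [Ordinal.add_sub_cancel_of_le hγ]

theorem reach_congr {A : OrdinalAutomaton Γ} {x y : Ordinal.{v} → Γ} {γ : Ordinal.{v}}
    (h : ∀ β < γ, x β = y β) (p q : A.State) : A.Reach x γ p q ↔ A.Reach y γ p q := by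
  constructor <;> rintro ⟨r, h0, h1, h2, h3⟩
  · exact ⟨r, h0, h1, fun β hβ => h β hβ ▸ h2 β hβ, h3⟩
  · exact ⟨r, h0, h1, fun β hβ => (h β hβ).symm ▸ h2 β hβ, h3⟩

/-- Runs split and glue at `γ`: the limit transition at `γ` belongs to the first part, and a limit
set beyond `γ` depends only on values taken after `γ`. -/
theorem reach_add {A : OrdinalAutomaton Γ} {x : Ordinal.{v} → Γ} {γ δ : Ordinal.{v}}
    {p q : A.State} :
    A.Reach x (γ + δ) p q ↔
      ∃ s, A.Reach x γ p s ∧ A.Reach (fun β => x (γ + β)) δ s q := by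
  constructor
  · rintro ⟨r, h0, h1, h2, h3⟩
    refine ⟨r γ, ⟨r, h0, rfl, fun β hβ => h2 β (hβ.trans_le le_self_add),
      fun β hβ => h3 β (hβ.trans le_self_add)⟩, fun β => r (γ + β), by simp, h1,
      fun β hβ => ?_, fun β hβ hl => ?_⟩
    · have := h2 (γ + β) (by simpa using hβ)
      rwa [Order.succ_eq_add_one, add_assoc, ← Order.succ_eq_add_one] at this
    · rw [cofinalValues_add r γ hl.bot_lt]
      exact h3 _ (by simpa using hβ) (isSuccLimit_add γ hl)
  · rintro ⟨s, ⟨r₁, h0, h1, h2, h3⟩, ⟨r₂, k0, k1, k2, k3⟩⟩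
    -- At `β = 0` the two runs agree, since both have the value `s` there.
    have hr (β : Ordinal.{v}) : (if γ + β ≤ γ then r₁ (γ + β) else r₂ (γ + β - γ)) = r₂ β := by
      split_ifs with h
      · have : β = 0 := by
          by_contra hb
          exact h.not_gt (lt_add_of_pos_right γ (pos_iff_ne_zero.2 hb))
        subst this
        simp [h1, k0]
      · rw [add_sub_cancel]
    refine ⟨fun β => if β ≤ γ then r₁ β else r₂ (β - γ), by simp [h0], by simp only [hr, k1],
      fun β hβ => ?_, fun β hβ hl => ?_⟩
    · rcases lt_or_ge β γ with h | h
      · simp only [h.le, if_true, succ_le_of_lt h]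
        exact h2 β h
      · obtain ⟨b, rfl⟩ : ∃ b, β = γ + b := ⟨β - γ, (Ordinal.add_sub_cancel_of_le h).symm⟩
        rw [Order.succ_eq_add_one, add_assoc, ← Order.succ_eq_add_one]
        simp only [hr]
        exact k2 b (by simpa using hβ)
    · rcases le_or_gt β γ with h | h
      · rw [cofinalValues_congr (g := r₁) hl.bot_lt fun c _ hc => if_pos (hc.le.trans h)]
        simp only [h, if_true]
        exact h3 β h hl
      · obtain ⟨b, rfl⟩ : ∃ b, β = γ + b := ⟨β - γ, (Ordinal.add_sub_cancel_of_le h.le).symm⟩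
        have hb : 0 < b := by
          rw [pos_iff_ne_zero]
          rintro rfl
          simp at h
        have hbl : IsSuccLimit b := by
          rcases isSuccLimit_add_iff.1 hl with hbl | hbl
          · exact hbl
          · exact absurd hbl.1 hb.ne'
        rw [← cofinalValues_add _ γ hb]
        simp only [hr]
        exact k3 b (by simpa using hβ) hbl

end OrdinalAutomaton

/-! ### Extension of words by blanks -/

section Extend

variable {Γ : Type u} [Inhabited Γ] {α : Ordinal.{v}}

open Classical in
/-- The extension of an `α`-word by blanks to all ordinals. -/
noncomputable def FinWord.extend (x : FinWord Γ α) (β : Ordinal.{v}) : Γ :=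
  if h : β < α then x.1 ⟨β, h⟩ else default

theorem FinWord.extend_of_lt (x : FinWord Γ α) {β : Ordinal.{v}} (h : β < α) :
    x.extend β = x.1 ⟨β, h⟩ := dif_pos h

theorem FinWord.extend_injective :
    Function.Injective (FinWord.extend : FinWord Γ α → Ordinal.{v} → Γ) := by
  intro x y h
  refine Subtype.ext (funext fun β => ?_)
  have := congrFun h β.1
  rwa [x.extend_of_lt β.2, y.extend_of_lt β.2] at this

theorem FinWord.finite_support_extend (x : FinWord Γ α) : {β | x.extend β ≠ default}.Finite := by
  refine (x.2.image Subtype.val).subset fun β hβ => ?_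
  by_cases h : β < α
  · exact ⟨⟨β, h⟩, by simpa [x.extend_of_lt h] using hβ, rfl⟩
  · exact absurd (dif_neg h) hβ

/-- The restriction of a word with finite support to the ordinals below `α`. -/
def FinWord.restrict (α : Ordinal.{v}) (f : Ordinal.{v} → Γ) (hf : {β | f β ≠ default}.Finite) :
    FinWord Γ α :=
  ⟨fun β => f β, hf.preimage Subtype.val_injective.injOn⟩

theorem FinWord.extend_restrict {f : Ordinal.{v} → Γ} (hf : {β | f β ≠ default}.Finite)
    {β : Ordinal.{v}} (h : β < α) : (FinWord.restrict α f hf).extend β = f β :=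
  FinWord.extend_of_lt _ h

theorem OrdinalAutomaton.mem_language_iff {A : OrdinalAutomaton Γ} {x : FinWord Γ α}
    {f : Ordinal.{v} → Γ} (hf : ∀ (β : Ordinal.{v}) (h : β < α), f β = x.1 ⟨β, h⟩) :
    x ∈ A.language α ↔ ∃ p ∈ A.initial, ∃ q ∈ A.final, A.Reach f α p q := by
  constructor
  · rintro ⟨r, ⟨h1, h2⟩, hi, hfin⟩
    -- Past `α` the run is continued constantly, which no condition sees.
    refine ⟨_, hi, _, hfin, fun β => r ⟨min β α, Set.mem_Iic.2 (min_le_right _ _)⟩, by simp, by simp,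
      fun β hβ => ?_, fun β hβ hl => ?_⟩
    · have := h1 β hβ
      simp only [min_eq_left hβ.le, min_eq_left (succ_le_of_lt hβ), hf β hβ]
      exact this
    · have := h2 β hβ hl
      simp only [min_eq_left hβ]
      convert this using 2
      ext q
      constructor
      · intro hq b hb
        obtain ⟨c, hc, hcβ, rfl⟩ := hq b hb
        exact ⟨⟨c, hcβ.le.trans hβ⟩, hc, hcβ, by simp only [min_eq_left (hcβ.le.trans hβ)]⟩
      · intro hq b hb
        obtain ⟨⟨c, hcα⟩, hc, hcβ, rfl⟩ := hq b hb
        exact ⟨c, hc, hcβ, by simp only [min_eq_left (Set.mem_Iic.1 hcα)]⟩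
  · rintro ⟨p, hp, q, hq, r, rfl, rfl, h2, h3⟩
    refine ⟨fun β => r β.1, ⟨fun β hβ => hf β hβ ▸ h2 β hβ, fun β hβ hl => ?_⟩, hp, hq⟩
    have := h3 β hβ hl
    convert this using 2
    ext s
    constructor
    · intro hs b hb
      obtain ⟨⟨c, hcα⟩, hc, hcβ, rfl⟩ := hs b hb
      exact ⟨c, hc, hcβ, rfl⟩
    · intro hs b hb
      obtain ⟨c, hc, hcβ, rfl⟩ := hs b hb
      exact ⟨⟨c, hcβ.le.trans hβ⟩, hc, hcβ, rfl⟩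

end Extend

/-! ### Decompositions of ordinals into indecomposable summands -/

/-- The starting points of the summands of a finite ordered sum of ordinals. -/
def starts : List Ordinal.{v} → Set Ordinal.{v}
  | [] => ∅
  | κ :: l => insert 0 ((κ + ·) '' starts l)

/-- All entries of the list are nonzero and additively indecomposable. -/
def Indecomposables (l : List Ordinal.{v}) : Prop :=
  ∀ κ ∈ l, κ ≠ 0 ∧ IsPrincipal (· + ·) κ

theorem encard_starts_le (l : List Ordinal.{v}) : (starts l).encard ≤ l.length := by
  induction l with
  | nil => simp [starts]
  | cons κ l ih =>
    refine (Set.encard_insert_le _ _).trans ?_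
    simpa using (Set.encard_image_le _ _).trans ih

theorem finite_starts (l : List Ordinal.{v}) : (starts l).Finite :=
  Set.finite_of_encard_le_coe (encard_starts_le l)

theorem starts_append (l l' : List Ordinal.{v}) :
    starts (l ++ l') = starts l ∪ (l.sum + ·) '' starts l' := by
  induction l with
  | nil => simp [starts]
  | cons κ l ih =>
    simp only [List.cons_append, starts, ih, Set.image_union, Set.image_image, List.sum_cons,
      add_assoc, Set.insert_union]

theorem exists_indecomposables (γ : Ordinal.{v}) : ∃ l, Indecomposables l ∧ l.sum = γ := by
  induction γ using WellFoundedLT.induction with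
  | ind γ ih =>
    rcases eq_or_ne γ 0 with rfl | h0
    · exact ⟨[], by simp [Indecomposables], rfl⟩
    by_cases hγ : IsPrincipal (· + ·) γ
    · exact ⟨[γ], by simp [Indecomposables, h0, hγ], by simp⟩
    obtain ⟨b, hb, c, hc, rfl⟩ := exists_lt_add_of_not_isPrincipal_add hγ
    obtain ⟨l, hl, rfl⟩ := ih b hb
    obtain ⟨l', hl', rfl⟩ := ih c hc
    refine ⟨l ++ l', fun κ hκ => ?_, by simp⟩
    exact (List.mem_append.1 hκ).elim (hl κ) (hl' κ)

/-- With `a` the largest point, decompose `a` so that the smaller points are starts, then append a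
decomposition of `γ - a`. Its first summand starts at `a`. -/
theorem exists_indecomposables_starts (s : Finset Ordinal.{v}) :
    ∀ γ : Ordinal.{v}, (∀ x ∈ s, x < γ) →
      ∃ l, Indecomposables l ∧ l.sum = γ ∧ ∀ x ∈ s, x ∈ starts l := by
  refine Finset.induction_on_max s ?_ ?_
  · intro γ _
    obtain ⟨l, hl, h⟩ := exists_indecomposables γ
    exact ⟨l, hl, h, by simp⟩
  · intro a s hs ih γ hγ
    obtain ⟨l, hl, hsum, hmem⟩ := ih a hs
    obtain ⟨l', hl', hsum'⟩ := exists_indecomposables (γ - a)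
    have ha : a < γ := hγ a (Finset.mem_insert_self _ _)
    refine ⟨l ++ l', fun κ hκ => (List.mem_append.1 hκ).elim (hl κ) (hl' κ), ?_, ?_⟩
    · rw [List.sum_append, hsum, hsum', Ordinal.add_sub_cancel_of_le ha.le]
    · intro x hx
      rw [starts_append]
      rcases Finset.mem_insert.1 hx with rfl | hx
      · right
        cases l' with
        | nil =>
          have := lt_sub.2 (show x + 0 < γ by simpa using ha)
          simp at hsum'
          exact absurd this (not_lt_of_ge hsum'.ge)
        | cons κ l' => exact ⟨0, by simp [starts], by simpa using hsum⟩
      · exact Or.inl (hmem x hx)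

/-! ### Types of words -/

section Types

variable {Γ : Type u} [Inhabited Γ]

/-- The convolution of two total words. -/
def pair (x y : Ordinal.{v} → Γ) (β : Ordinal.{v}) : Fin 2 → Γ := ![x β, y β]

/-- The word whose only nonblank letter is `a` at position zero. -/
noncomputable def lead (a : Γ) (β : Ordinal.{v}) : Γ :=
  open Classical in if β = 0 then a else default

variable (D : OrdinalAutomaton Γ) (E : OrdinalAutomaton (Fin 2 → Γ))

/-- On the ordinals below `γ`, the words `x` and `y` admit the same runs of `D`, and so do for `E`
their convolutions with any word supported in `X`. -/
def SameType (X : Set Ordinal.{v}) (γ : Ordinal.{v}) (x y : Ordinal.{v} → Γ) : Prop :=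
  (∀ p q, D.Reach x γ p q ↔ D.Reach y γ p q) ∧
    ∀ z : Ordinal.{v} → Γ, (∀ β, z β ≠ default → β ∈ X) →
      ∀ p q, E.Reach (pair x z) γ p q ↔ E.Reach (pair y z) γ p q

/-- The type of a word of length `γ`, which determines its class under `SameType D E {0} γ`. -/
def wordType (γ : Ordinal.{v}) (x : Ordinal.{v} → Γ) :
    Set (D.State × D.State) × (Γ → Set (E.State × E.State)) :=
  ({p | D.Reach x γ p.1 p.2}, fun a => {p | E.Reach (pair x (lead a)) γ p.1 p.2})

variable {D E}

theorem eq_lead {z : Ordinal.{v} → Γ} (hz : ∀ β, z β ≠ default → β ∈ ({0} : Set Ordinal.{v})) :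
    z = lead (z 0) := by
  funext β
  by_cases h : β = 0
  · simp [lead, h]
  · simp only [lead, h, if_false]
    by_contra h'
    exact h (hz β h')

theorem sameType_of_eqOn {X : Set Ordinal.{v}} {γ : Ordinal.{v}} {x y : Ordinal.{v} → Γ}
    (h : ∀ β < γ, x β = y β) : SameType D E X γ x y :=
  ⟨OrdinalAutomaton.reach_congr h,
    fun z _ => OrdinalAutomaton.reach_congr fun β hβ => by simp only [pair, h β hβ]⟩

theorem SameType.trans {X : Set Ordinal.{v}} {γ : Ordinal.{v}} {x y z : Ordinal.{v} → Γ}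
    (h : SameType D E X γ x y) (h' : SameType D E X γ y z) : SameType D E X γ x z :=
  ⟨fun p q => (h.1 p q).trans (h'.1 p q),
    fun t ht p q => (h.2 t ht p q).trans (h'.2 t ht p q)⟩

open Classical in
/-- The word that agrees with `x` below `κ` and continues with `y` from `κ` on. -/
noncomputable def concat (κ : Ordinal.{v}) (x y : Ordinal.{v} → Γ) (β : Ordinal.{v}) : Γ :=
  if β < κ then x β else y (β - κ)

/-- Equality of types is compatible with concatenation. -/
theorem SameType.append {X Y Z : Set Ordinal.{v}} {κ σ : Ordinal.{v}}
    {x y y' : Ordinal.{v} → Γ} (hXκ : ∀ β ∈ X, β < κ → β ∈ Y)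
    (hXZ : ∀ β, κ + β ∈ X → β ∈ Z)
    (h : SameType D E Y κ x y) (h' : SameType D E Z σ (fun β => x (κ + β)) y') :
    SameType D E X (κ + σ) x (concat κ y y') := by
  classical
  have c1 : ∀ β < κ, concat κ y y' β = y β := fun β hβ => if_pos hβ
  have c2 : ∀ β, concat κ y y' (κ + β) = y' β := fun β => by
    simp [concat]
  constructor
  · intro p q
    rw [OrdinalAutomaton.reach_add, OrdinalAutomaton.reach_add]
    refine exists_congr fun s => and_congr ?_ ?_
    · rw [h.1, OrdinalAutomaton.reach_congr c1]
    · simp only [c2]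
      exact h'.1 s q
  · intro z hz p q
    rw [OrdinalAutomaton.reach_add, OrdinalAutomaton.reach_add]
    refine exists_congr fun s => and_congr ?_ ?_
    -- The hypothesis restricts the support of the test word on all ordinals, so `z` is cut off at
    -- `κ`.
    · have := h.2 (fun β => if β < κ then z β else default) (fun β hβ => by
        split_ifs at hβ with hβκ
        · exact hXκ β (hz β hβ) hβκ
        · exact absurd rfl hβ) p s
      refine (OrdinalAutomaton.reach_congr (fun β hβ => ?_) p s).trans
        (this.trans (OrdinalAutomaton.reach_congr (fun β hβ => ?_) p s))
      · simp only [pair, hβ, if_true]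
      · simp only [pair, hβ, if_true, c1]
    · have := h'.2 (fun β => z (κ + β)) (fun β hβ => hXZ β (hz _ hβ)) s q
      have e : (fun β => pair (concat κ y y') z (κ + β)) = pair y' fun β => z (κ + β) :=
        funext fun β => by simp only [pair, c2]
      rw [e]
      exact this

/-- Since `γ` and `γ'` are absorbed by `κ`, both prefixes are followed by the same blank word of
length `κ`. As they are nonzero, the only possibly nonblank letter of the test word falls inside the
prefix. -/
theorem sameType_singleton_of_wordType_eq {γ γ' κ : Ordinal.{v}} {x y : Ordinal.{v} → Γ}
    (h0 : γ ≠ 0) (h0' : γ' ≠ 0) (h : wordType D E γ x = wordType D E γ' y)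
    (hx : ∀ β, γ ≤ β → x β = default) (hy : ∀ β, γ' ≤ β → y β = default)
    (hκ : γ + κ = κ) (hκ' : γ' + κ = κ) : SameType D E {0} κ x y := by
  have hx' : ∀ β, x (γ + β) = default := fun β => hx _ le_self_add
  have hy' : ∀ β, y (γ' + β) = default := fun β => hy _ le_self_add
  have hl : ∀ (a : Γ) (β : Ordinal.{v}), lead a (γ + β) = default := fun a β =>
    if_neg fun h => h0 (nonpos_iff_eq_zero.1 (le_self_add.trans h.le))
  have hl' : ∀ (a : Γ) (β : Ordinal.{v}), lead a (γ' + β) = default := fun a β =>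
    if_neg fun h => h0' (nonpos_iff_eq_zero.1 (le_self_add.trans h.le))
  have h1 := fun p q => Set.ext_iff.1 (congrArg Prod.fst h) (p, q)
  have h2 := fun a p q => Set.ext_iff.1 (congrFun (congrArg Prod.snd h) a) (p, q)
  simp only [wordType, Set.mem_ofPred_eq] at h1 h2
  constructor
  · intro p q
    have k1 := OrdinalAutomaton.reach_add (A := D) (x := x) (γ := γ) (δ := κ) (p := p) (q := q)
    have k2 := OrdinalAutomaton.reach_add (A := D) (x := y) (γ := γ') (δ := κ) (p := p) (q := q)
    rw [hκ] at k1
    rw [hκ'] at k2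
    rw [k1, k2]
    simp only [hx', hy', h1]
  · intro z hz p q
    have k1 := OrdinalAutomaton.reach_add (A := E) (x := pair x (lead (z 0))) (γ := γ) (δ := κ)
      (p := p) (q := q)
    have k2 := OrdinalAutomaton.reach_add (A := E) (x := pair y (lead (z 0))) (γ := γ') (δ := κ)
      (p := p) (q := q)
    have e1 : (fun β => pair x (lead (z 0)) (γ + β)) = fun _ => ![default, default] :=
      funext fun β => by simp only [pair, hx', hl]
    have e2 : (fun β => pair y (lead (z 0)) (γ' + β)) = fun _ => ![default, default] :=
      funext fun β => by simp only [pair, hy', hl']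
    rw [hκ, e1] at k1
    rw [hκ', e2] at k2
    rw [eq_lead hz, k1, k2]
    exact exists_congr fun s => and_congr_left fun _ => h2 _ p s

/-- Some word of length `γ > 0` with finite support has type `t`. -/
def Realizes (t : Set (D.State × D.State) × (Γ → Set (E.State × E.State))) (γ : Ordinal.{v}) :
    Prop :=
  γ ≠ 0 ∧ ∃ x : Ordinal.{v} → Γ, {β | x β ≠ default}.Finite ∧ (∀ β, γ ≤ β → x β = default) ∧
    wordType D E γ x = t

variable (D E) in
/-- Every word of indecomposable length `κ` can be replaced by one supported at the starting
points of a decomposition of `κ` whose length is bounded independently of `κ`. -/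
theorem exists_replacement_of_isPrincipal [Finite Γ] :
    ∃ C : ℕ, ∀ κ : Ordinal.{v}, κ ≠ 0 → IsPrincipal (· + ·) κ →
      ∃ l : List Ordinal.{v}, Indecomposables l ∧ l.sum = κ ∧ l.length ≤ C ∧
        ∀ x : Ordinal.{v} → Γ, {β | x β ≠ default}.Finite →
          ∃ y : Ordinal.{v} → Γ, (∀ β, y β ≠ default → β ∈ starts l) ∧
            SameType D E {0} κ x y := by
  classical
  have := D.finite_state
  have := E.finite_state
  let T := Set (D.State × D.State) × (Γ → Set (E.State × E.State))
  have := Fintype.ofFinite T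
  -- The least length realizing `t`; this choice does not depend on `κ`.
  let g : T → Ordinal.{v} := fun t => sInf {γ | Realizes t γ}
  have hg : ∀ (t : T) (γ : Ordinal.{v}), Realizes t γ → Realizes t (g t) ∧ g t ≤ γ :=
    fun t γ h => ⟨csInf_mem (s := {γ | Realizes t γ}) ⟨γ, h⟩, csInf_le' h⟩
  have hu : ∀ t : T, ∃ u : Ordinal.{v} → Γ, {β | u β ≠ default}.Finite ∧
      (∀ β, g t ≤ β → u β = default) ∧
      ((∃ γ : Ordinal.{v}, Realizes t γ) → g t ≠ 0 ∧ wordType D E (g t) u = t) := by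
    intro t
    by_cases h : ∃ γ : Ordinal.{v}, Realizes t γ
    · obtain ⟨γ, hγ⟩ := h
      obtain ⟨h0, u, h1, h2, h3⟩ := (hg t γ hγ).1
      exact ⟨u, h1, h2, fun _ => ⟨h0, h3⟩⟩
    · exact ⟨fun _ => default, by simp, by simp, fun h' => absurd h' h⟩
  choose u hu1 hu2 hu3 using hu
  -- One decomposition serves the representatives of all types in `A`. There are finitely many sets
  -- `A`, whatever `κ` is, which bounds the length uniformly.
  have hlist : ∀ A : Finset T, ∃ l : List Ordinal.{v}, Indecomposables l ∧ l.sum = A.sup g ∧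
      ∀ t ∈ A, ∀ β, u t β ≠ default → β ∈ starts l := by
    intro A
    obtain ⟨l, hl, hsum, hmem⟩ := exists_indecomposables_starts
      (A.biUnion fun t => (hu1 t).toFinset) (A.sup g) (fun β hβ => by
        simp only [Finset.mem_biUnion, Set.Finite.mem_toFinset, Set.mem_ofPred_eq] at hβ
        obtain ⟨t, ht, hβ⟩ := hβ
        refine lt_of_lt_of_le ?_ (Finset.le_sup ht)
        by_contra hle
        exact hβ (hu2 t β (not_lt.1 hle)))
    refine ⟨l, hl, hsum, fun t ht β hβ => hmem β ?_⟩
    simp only [Finset.mem_biUnion, Set.Finite.mem_toFinset, Set.mem_ofPred_eq]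
    exact ⟨t, ht, hβ⟩
  choose f hf1 hf2 hf3 using hlist
  -- The extra `1` counts the final summand `κ`, which absorbs the sum of `f A`.
  refine ⟨(Finset.univ.sup fun A => (f A).length) + 1, fun κ h0 hκ => ?_⟩
  -- No nonzero length lies below `1`, so this case is separate.
  rcases eq_or_ne κ 1 with rfl | h1
  · refine ⟨[1], by simp [Indecomposables], by simp, by simp, fun x _ => ⟨lead (x 0), ?_, ?_⟩⟩
    · intro β hβ
      by_contra h
      exact hβ (if_neg (by simpa [starts] using h))
    · refine sameType_of_eqOn fun β hβ => ?_
      rw [Order.lt_one_iff] at hβ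
      simp [lead, hβ]
  have h1κ : 1 < κ := lt_of_le_of_ne (Order.one_le_iff_ne_zero.2 h0) (Ne.symm h1)
  let A : Finset T := Finset.univ.filter fun t => ∃ γ < κ, Realizes t γ
  have hσ : A.sup g < κ := by
    refine (Finset.sup_lt_iff (pos_iff_ne_zero.2 h0)).2 fun t ht => ?_
    obtain ⟨γ, hγ, hr⟩ := (Finset.mem_filter.1 ht).2
    exact (hg t γ hr).2.trans_lt hγ
  refine ⟨f A ++ [κ], fun κ' hκ' => ?_, ?_, ?_, fun x hx => ?_⟩
  · rcases List.mem_append.1 hκ' with h | h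
    · exact hf1 A κ' h
    · rw [List.mem_singleton.1 h]
      exact ⟨h0, hκ⟩
  · rw [List.sum_append, hf2, List.sum_singleton, hκ.add_eq_right hσ]
  · simpa using Finset.le_sup (f := fun A => (f A).length) (Finset.mem_univ A)
  -- Letters at or past `κ` are erased so that the support is bounded below `κ`.
  let x' : Ordinal.{v} → Γ := fun β => if β < κ then x β else default
  have hxx' : SameType D E {0} κ x x' := sameType_of_eqOn fun β hβ => (if_pos hβ).symm
  have hx' : {β | x' β ≠ default}.Finite := hx.subset fun β hβ h => hβ (by simp [x', h])
  let γ : Ordinal.{v} := hx'.toFinset.sup (fun β => β + 1) + 1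
  have hγκ : γ < κ := by
    refine hκ ((Finset.sup_lt_iff (pos_iff_ne_zero.2 h0)).2 fun β hβ => hκ ?_ h1κ) h1κ
    by_contra h
    exact (hx'.mem_toFinset.1 hβ) (if_neg h)
  have hxγ : ∀ β, γ ≤ β → x' β = default := by
    intro β hβ
    by_contra h
    have h1 : β + 1 ≤ hx'.toFinset.sup (fun β => β + 1) :=
      Finset.le_sup (f := fun β : Ordinal.{v} => β + 1) (hx'.mem_toFinset.2 h)
    have h2 : β < β + 1 := lt_add_one β
    have h3 : hx'.toFinset.sup (fun β => β + 1) < γ := lt_add_one _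
    exact absurd hβ (h2.trans_le (h1.trans h3.le)).not_ge
  have hγ0 : γ ≠ 0 := by simp [γ]
  have hR : Realizes (wordType D E γ x') γ := ⟨hγ0, x', hx', hxγ, rfl⟩
  have hA : wordType D E γ x' ∈ A := Finset.mem_filter.2 ⟨Finset.mem_univ _, γ, hγκ, hR⟩
  have h3 := hu3 _ ⟨γ, hR⟩
  refine ⟨u (wordType D E γ x'), fun β hβ => ?_, hxx'.trans ?_⟩
  · rw [starts_append]
    exact Or.inl (hf3 A _ hA β hβ)
  · exact sameType_singleton_of_wordType_eq hγ0 h3.1 h3.2.symm hxγ (hu2 _)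
      (hκ.add_eq_right hγκ) (hκ.add_eq_right ((Finset.le_sup (f := g) hA).trans_lt hσ))

variable (D E) in
/-- Every decomposition has a refinement of proportional length at whose starting points all types
of words with respect to the given decomposition are realized. -/
theorem exists_replacement [Finite Γ] :
    ∃ C : ℕ, ∀ l : List Ordinal.{v}, Indecomposables l →
      ∃ l' : List Ordinal.{v}, Indecomposables l' ∧ l'.sum = l.sum ∧ l'.length ≤ C * l.length ∧
        ∀ x : Ordinal.{v} → Γ, {β | x β ≠ default}.Finite →
          ∃ y : Ordinal.{v} → Γ, (∀ β, y β ≠ default → β ∈ starts l') ∧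
            SameType D E (starts l) l.sum x y := by
  obtain ⟨C, hC⟩ := exists_replacement_of_isPrincipal.{u, v} D E
  refine ⟨C, fun l => ?_⟩
  induction l with
  | nil =>
    exact fun _ => ⟨[], by simp [Indecomposables], rfl, by simp, fun x _ =>
      ⟨fun _ => default, by simp, sameType_of_eqOn fun β hβ => absurd hβ (by simp)⟩⟩
  | cons κ l ih =>
    intro hl
    have hκ := hl κ (by simp)
    obtain ⟨l₁, hl₁, hs₁, hn₁, hx₁⟩ := hC κ hκ.1 hκ.2
    obtain ⟨l₂, hl₂, hs₂, hn₂, hx₂⟩ := ih fun κ' h => hl κ' (by simp [h])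
    refine ⟨l₁ ++ l₂, fun κ' h => (List.mem_append.1 h).elim (hl₁ κ') (hl₂ κ'), by simp [hs₁, hs₂],
      ?_, fun x hx => ?_⟩
    · simp only [List.length_append, List.length_cons]
      linarith
    obtain ⟨y₁, hy₁, h₁⟩ := hx₁ x hx
    obtain ⟨y₂, hy₂, h₂⟩ := hx₂ (fun β => x (κ + β))
      (hx.preimage (f := fun β => κ + β) fun a _ b _ h => by simpa using h)
    refine ⟨concat κ y₁ y₂, fun β hβ => ?_, ?_⟩
    · rw [starts_append, hs₁]
      unfold concat at hβ
      split_ifs at hβ with h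
      · exact Or.inl (hy₁ β hβ)
      · exact Or.inr ⟨β - κ, hy₂ _ hβ, Ordinal.add_sub_cancel_of_le (not_lt.1 h)⟩
    · rw [List.sum_cons]
      -- Below `κ` the only start is `0`; from `κ` on the starts are those of `l`, shifted.
      refine h₁.append ?_ ?_ h₂
      · rintro β (rfl | ⟨δ, -, rfl⟩) hβ
        · rfl
        · exact absurd hβ (by simp)
      · rintro β (h | ⟨δ, hδ, h⟩)
        · exact absurd (nonpos_iff_eq_zero.1 (le_self_add.trans h.le)) hκ.1
        · rwa [← show δ = β by simpa using h]

end Types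

/-! ### Counting -/

theorem ncard_words_le {Γ : Type u} [Inhabited Γ] [Finite Γ] (α : Ordinal.{v})
    (l : List Ordinal.{v}) :
    {x : FinWord Γ α | ∀ β, x.extend β ≠ default → β ∈ starts l}.Finite ∧
    {x : FinWord Γ α | ∀ β, x.extend β ≠ default → β ∈ starts l}.ncard ≤
      Nat.card Γ ^ l.length := by
  have := (finite_starts l).to_subtype
  let F : {x : FinWord Γ α | ∀ β, x.extend β ≠ default → β ∈ starts l} → (starts l → Γ) :=
    fun x β => x.1.extend β
  have hF : Function.Injective F := by
    intro x y h
    refine Subtype.ext (FinWord.extend_injective (funext fun β => ?_))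
    by_cases hβ : β ∈ starts l
    · exact congrFun h ⟨β, hβ⟩
    · rw [not_imp_comm.1 (x.2 β) hβ, not_imp_comm.1 (y.2 β) hβ]
  refine ⟨Set.finite_coe_iff.1 (Finite.of_injective F hF), ?_⟩
  have h1 := Nat.card_le_card_of_injective F hF
  rw [Nat.card_fun] at h1
  refine h1.trans (Nat.pow_le_pow_right Nat.card_pos ?_)
  have := encard_starts_le l
  rw [← (finite_starts l).cast_ncard_eq] at this
  exact_mod_cast this

/-- In a graph with the extension property, if the neighbourhoods in a finite set `S` of arbitrary
vertices are realized by vertices in a finite set `S'`, then `S'` is exponentially larger. -/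
theorem two_pow_ncard_le {V : Type u} {G : SimpleGraph V} (hG : G.IsRandomGraph) {S S' : Set V}
    (hS : S.Finite) (hS' : S'.Finite)
    (h : ∀ a, ∃ b ∈ S', ∀ c ∈ S, G.Adj a c ↔ G.Adj b c) : 2 ^ S.ncard ≤ S'.ncard := by
  classical
  have key : ∀ A : Finset V, ∃ b ∈ S', ∀ c ∈ S, G.Adj b c ↔ c ∈ A := by
    intro A
    obtain ⟨a, ha1, ha2⟩ := hG.2 (hS.toFinset ∩ A) (hS.toFinset \ A)
      (Finset.disjoint_left.2 fun c hc hc' => by simp_all)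
    obtain ⟨b, hb, hbc⟩ := h a
    refine ⟨b, hb, fun c hc => (hbc c hc).symm.trans ⟨fun hac => ?_, fun hcA => ?_⟩⟩
    · by_contra hcA
      exact ha2 c (by simp [hc, hcA]) hac
    · exact ha1 c (by simp [hc, hcA])
  choose b hb hbc using key
  rw [Set.ncard_eq_toFinset_card S hS, Set.ncard_eq_toFinset_card S' hS', ← Finset.card_powerset]
  refine Finset.card_le_card_of_injOn b (fun A _ => by simpa using hb A) fun A hA B hB hAB => ?_
  simp only [Finset.coe_powerset, Set.mem_preimage, Set.mem_powerset_iff] at hA hB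
  ext c
  constructor
  · intro hc
    have hcS : c ∈ S := by simpa using hA hc
    exact (hbc B c hcS).1 (hAB ▸ (hbc A c hcS).2 hc)
  · intro hc
    have hcS : c ∈ S := by simpa using hB hc
    exact (hbc A c hcS).1 (hAB ▸ (hbc B c hcS).2 hc)

/-- A sequence that grows like iterated exponentials is not doubly exponentially bounded. -/
theorem not_two_pow_le_succ {a : ℕ → ℕ} {K C c : ℕ} (ha : ∀ n, a n ≤ K ^ (C ^ n * c)) :
    ¬ ∀ n, 2 ^ a n ≤ a (n + 1) := by
  intro h
  have hn : ∀ n, n ≤ a n := fun n => by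
    induction n with
    | zero => exact Nat.zero_le _
    | succ n ih => exact (ih.trans_lt Nat.lt_two_pow_self).trans_le (h n)
  -- Two steps of the recursion against the bound at `n + 2` remove two exponentials, so `a` is at
  -- most linear.
  have h1 : ∀ n, 2 ^ a n ≤ 2 ^ (C * (n + 2) + K + c) := by
    intro n
    have e : 2 ^ a (n + 1) ≤ 2 ^ (K * (C ^ (n + 2) * c)) := by
      refine ((h (n + 1)).trans (ha (n + 2))).trans ?_
      rw [pow_mul 2]
      exact Nat.pow_le_pow_left Nat.lt_two_pow_self.le _
    have e' := (h n).trans ((Nat.pow_le_pow_iff_right (by norm_num)).1 e)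
    refine e'.trans ?_
    rw [pow_add 2, pow_add 2, pow_mul 2, mul_comm K, mul_assoc, mul_assoc, mul_comm c]
    exact Nat.mul_le_mul (Nat.pow_le_pow_left Nat.lt_two_pow_self.le _)
      (Nat.mul_le_mul Nat.lt_two_pow_self.le Nat.lt_two_pow_self.le)
  have h2 : ∀ n, a n ≤ C * (n + 2) + K + c := fun n =>
    (Nat.pow_le_pow_iff_right (by norm_num)).1 (h1 n)
  set B := C * 3 + K + c with hB
  have h3 : ∀ n, 2 ^ n ≤ B * (n + 1) := fun n => by
    refine ((Nat.pow_le_pow_right (by norm_num) (hn n)).trans (h n)).trans ((h2 _).trans ?_)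
    rw [hB]
    nlinarith [Nat.zero_le (C * n), Nat.zero_le (K * n), Nat.zero_le (c * n)]
  -- Here the left side is at least `(B + 2) ^ 3`, while the right side is quadratic in `B`.
  have h4 := h3 (3 * (B + 1))
  rw [pow_mul'] at h4
  have h5 : B + 2 ≤ 2 ^ (B + 1) := Nat.lt_two_pow_self
  have h6 := (Nat.pow_le_pow_left h5 3).trans h4
  nlinarith [Nat.zero_le (B ^ 3)]

/-! ### Iterated refinement of the presentation -/

theorem not_isAutomatic_of_isRandomGraph {V : Type u} {G : SimpleGraph V}
    (hG : G.IsRandomGraph) (α : Ordinal.{v}) :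
    ¬ IsAutomatic α FirstOrder.Language.graph V G.structure := by
  let := G.structure
  rintro ⟨P, ⟨e⟩⟩
  have := P.finite_alphabet
  let E := P.rel 2 FirstOrder.Language.adj
  let φ : P.domain.language α → V := fun a => e (Quotient.mk P.setoid a)
  have hφ : Function.Surjective φ := fun a => by
    obtain ⟨b, hb⟩ := Quotient.exists_rep (e.symm a)
    exact ⟨b, by simp only [φ, hb, FirstOrder.Language.Equiv.apply_symm_apply]⟩
  have hadj : ∀ a b, G.Adj (φ a) (φ b) ↔ ∃ p ∈ E.initial, ∃ q ∈ E.final,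
      E.Reach (pair a.1.extend b.1.extend) α p q := by
    intro a b
    have h1 := e.map_rel FirstOrder.Language.adj fun i => Quotient.mk P.setoid (![a, b] i)
    rw [FirstOrder.Language.relMap_quotient_mk'] at h1
    refine Iff.trans h1 (OrdinalAutomaton.mem_language_iff fun β hβ => funext fun i => ?_)
    fin_cases i
    · exact a.1.extend_of_lt hβ
    · exact b.1.extend_of_lt hβ
  have hdom : ∀ x : FinWord P.Alphabet α, x ∈ P.domain.language α ↔
      ∃ p ∈ P.domain.initial, ∃ q ∈ P.domain.final, P.domain.Reach x.extend α p q :=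
    fun x => OrdinalAutomaton.mem_language_iff fun β hβ => x.extend_of_lt hβ
  obtain ⟨C, hC⟩ := exists_replacement.{0, v} P.domain E
  choose! g hg1 hg2 hg3 hg4 using hC
  obtain ⟨l₀, hl₀, hs₀⟩ := exists_indecomposables α
  let l : ℕ → List Ordinal.{v} := fun n => g^[n] l₀
  have hsucc : ∀ n, l (n + 1) = g (l n) := fun n => Function.iterate_succ_apply' g n l₀
  have hl : ∀ n, Indecomposables (l n) ∧ (l n).sum = α ∧ (l n).length ≤ C ^ n * l₀.length := by
    intro n
    induction n with
    | zero => exact ⟨hl₀, hs₀, by simp [l]⟩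
    | succ n ih =>
      rw [hsucc]
      refine ⟨hg1 _ ih.1, (hg2 _ ih.1).trans ih.2.1, (hg3 _ ih.1).trans ?_⟩
      rw [pow_succ', mul_assoc]
      exact Nat.mul_le_mul_left C ih.2.2
  let W : ℕ → Set (FinWord P.Alphabet α) := fun n =>
    {x | ∀ β, x.extend β ≠ default → β ∈ starts (l n)}
  let S : ℕ → Set V := fun n => φ '' (Subtype.val ⁻¹' W n)
  have hW : ∀ n, (Subtype.val ⁻¹' W n : Set (P.domain.language α)).Finite := fun n =>
    (ncard_words_le α (l n)).1.preimage Subtype.val_injective.injOn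
  refine not_two_pow_le_succ (a := fun n => (S n).ncard) (K := Nat.card P.Alphabet) (C := C)
    (c := l₀.length) (fun n => ?_) fun n => ?_
  · calc (S n).ncard ≤ (Subtype.val ⁻¹' W n : Set (P.domain.language α)).ncard :=
          Set.ncard_image_le (hW n)
      _ = (Subtype.val '' (Subtype.val ⁻¹' W n : Set (P.domain.language α))).ncard :=
          (Set.ncard_image_of_injective _ Subtype.val_injective).symm
      _ ≤ (W n).ncard := Set.ncard_le_ncard (Set.image_preimage_subset _ _)
          (ncard_words_le α (l n)).1
      _ ≤ Nat.card P.Alphabet ^ (l n).length := (ncard_words_le α (l n)).2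
      _ ≤ _ := Nat.pow_le_pow_right Nat.card_pos (hl n).2.2
  · refine two_pow_ncard_le hG ((hW n).image φ) ((hW (n + 1)).image φ) fun v => ?_
    obtain ⟨a, rfl⟩ := hφ v
    obtain ⟨y, hy, ht⟩ := hg4 _ (hl n).1 a.1.extend a.1.finite_support_extend
    rw [(hl n).2.1] at ht
    rw [← hsucc] at hy
    -- Cutting `y` off at `α` leaves its type on `α` unchanged. The type includes the runs of the
    -- domain automaton, so `b` again represents a vertex.
    let b := FinWord.restrict α y ((finite_starts _).subset hy)
    have hb : ∀ β < α, y β = b.extend β := fun β hβ => (FinWord.extend_restrict _ hβ).symm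
    have ht' := ht.trans (sameType_of_eqOn hb)
    have hbD : b ∈ P.domain.language α := by
      rw [hdom]
      simpa only [ht'.1] using (hdom a.1).1 a.2
    refine ⟨φ ⟨b, hbD⟩, ⟨⟨b, hbD⟩, fun β hβ => ?_, rfl⟩, ?_⟩
    · by_cases h : β < α
      · exact hy β (by rwa [hb β h])
      · exact absurd (dif_neg h) hβ
    · rintro _ ⟨c, hc, rfl⟩
      simp only [hadj, ht'.2 c.1.extend hc]

end OrdinalAutomata

theorem mainTheorem3 {V : Type u} (G : SimpleGraph V) (hG : G.IsRandomGraph) (α : Ordinal.{v}) :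
    ¬ OrdinalAutomata.IsAutomatic α FirstOrder.Language.graph V G.structure :=
  OrdinalAutomata.not_isAutomatic_of_isRandomGraph hG α
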